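/- **Setting.** Let $\phi:\mathbb R\to\mathbb R$ be odd and five times differentiable with bounded first, third and fifth derivatives, and let $L\in\mathbb N$. Let $d=d_0\ge 1$ and let $d_1,\dots,d_L$ be proportional to $d$: $\gamma^{-1}d\le d_\ell\le\gamma d$ for a fixed $\gamma\ge 1$. Let $\mathbf x=\mathbf x^{(0)}$ be a random vector in $\mathbb R^{d}$ with $\mathbb E\,\mathbf x=0$ that satisfies the Lipschitz Concentration Property with some parameter $\sigma>0$, $\sigma^2\le c/d$: for every $K'$-Lipschitz $f:\mathbb R^d\to\mathbb R$ and every $t>0$, $\mathbb P(|f(\mathbf x)-\mathbb E f(\mathbf x)|\ge t)\le 2\exp\!\big(-t^2/(2K'^2\sigma^2)\big)$. Let $\mathbf W^{(\ell)}\in\mathbb R^{d_\ell\times d_{\ell-1}}$, $\ell=1,\dots,L$, be fixed matrices whose rows $\mathbf w^{(\ell)}_i$ satisfy $|(\mathbf w^{(\ell)}_i)^T\mathbf w^{(\ell)}_j-\delta_{ij}|\le C/\sqrt{d_\ell}$ for all $i,j$ (here $\delta_{ij}$ is the Kronecker delta), and with $\|\mathbf W^{(\ell)}\|\le K$; here $\|\cdot\|$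 is the operator norm. Put $\mathbf x^{(\ell)}=\phi(\mathbf W^{(\ell)}\mathbf x^{(\ell-1)})$ entrywise, and $$\boldsymbol\Sigma_\ell=\mathbb E\big[\mathbf x^{(\ell)}(\mathbf x^{(\ell)})^T\big],\qquad \sigma_\ell^2=\frac{\operatorname{Tr}\boldsymbol\Sigma_\ell}{d_\ell},\qquad \ell=0,\dots,L .$$ For $\ell\ge1$ and $z\sim\mathcal N(0,\sigma_{\ell-1}^2)$ let $$\rho_{\ell,1}=\frac{1}{\sigma_{\ell-1}^2}\,\mathbb E[z\phi(z)],\qquad \rho_{\ell,2}^2=\mathbb E[\phi(z)^2]-\sigma_{\ell-1}^2\rho_{\ell,1}^2$$ (with $\rho_{\ell,1}=0$ if $\sigma_{\ell-1}=0$), and $$\tilde{\boldsymbol\Sigma}_0=\boldsymbol\Sigma_0,\qquad \tilde{\boldsymbol\Sigma}_\ell=\rho_{\ell,1}^2\,\mathbf W^{(\ell)}\boldsymbol\Sigma_{\ell-1}(\mathbf W^{(\ell)})^T+\rho_{\ell,2}^2\,\mathbf I .$$ **Claim.** For every $A>0$ there is a constant $M$, depending only on $\phi,L,c,C,K,\gamma,A$,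 such that for all such data, all $1\le\ell\le L$ and all $\delta_{\ell-1}\in\mathbb R$: if $\|\boldsymbol\Sigma_{\ell-1}-\tilde{\boldsymbol\Sigma}_{\ell-1}\|\le A\,\delta_{\ell-1}$, then $$\|\boldsymbol\Sigma_{\ell}-\tilde{\boldsymbol\Sigma}_{\ell}\|\le M\Big(\frac{m}{d^2}+\rho_{\ell,1}^2\,\|\mathbf W^{(\ell)}\|^2\,\delta_{\ell-1}\Big),\qquad m=d_\ell .$$ The same implication, with the same $M$, holds with $\tilde{\boldsymbol\Sigma}$ replaced throughout by the iterated approximation $\mathbf S_0=\boldsymbol\Sigma_0$, $\mathbf S_\ell=\rho_{\ell,1}^2\,\mathbf W^{(\ell)}\mathbf S_{\ell-1}(\mathbf W^{(\ell)})^T+\rho_{\ell,2}^2\,\mathbf I$. -/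

import Mathlib

open MeasureTheory ProbabilityTheory
open scoped NNReal Matrix Matrix.Norms.L2Operator

noncomputable section

namespace DeepRF

/-- Lipschitz Concentration Property with parameter `σ > 0` for a random vector of law `μ` in
Euclidean space: for every `K`-Lipschitz `f` and every `t > 0`,
`ℙ (|f - 𝔼 f| ≥ t) ≤ 2 exp (-t² / (2 K² σ²))`. (A `0`-Lipschitz function is constant, so the
case `K = 0` carries no information; the bound forces every Lipschitz `f` to be integrable.) -/
def LCP {n : ℕ} (μ : Measure (EuclideanSpace ℝ (Fin n))) (σ : ℝ) : Prop :=
  0 < σ ∧ ∀ (K : ℝ≥0) (f : EuclideanSpace ℝ (Fin n) → ℝ), LipschitzWith K f →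
    ∀ t : ℝ, 0 < t →
      μ.real {z | t ≤ |f z - ∫ y, f y ∂μ|} ≤
        2 * Real.exp (-t ^ 2 / (2 * (K : ℝ) ^ 2 * σ ^ 2))

/-- Odd, five times differentiable, with bounded first, third and fifth derivatives. -/
structure Activation (φ : ℝ → ℝ) : Prop where
  odd : ∀ z, φ (-z) = -φ z
  differentiable : ∀ k < 5, Differentiable ℝ (iteratedDeriv k φ)
  bounded_one : ∃ B : ℝ, ∀ z, |iteratedDeriv 1 φ z| ≤ B
  bounded_three : ∃ B : ℝ, ∀ z, |iteratedDeriv 3 φ z| ≤ B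
  bounded_five : ∃ B : ℝ, ∀ z, |iteratedDeriv 5 φ z| ≤ B

/-- Near-orthonormal rows: `|⟨wᵢ, wⱼ⟩ - δᵢⱼ| ≤ C / √m` for the rows of an `m × n` matrix. -/
def NearOrthonormalRows {m n : ℕ} (W : Matrix (Fin m) (Fin n) ℝ) (C : ℝ) : Prop :=
  ∀ i j : Fin m, |W i ⬝ᵥ W j - (if i = j then 1 else 0)| ≤ C / Real.sqrt m

/-- `ρ₁ = v⁻¹ 𝔼 [z φ(z)]` for `z ∼ N(0, v)`. -/
def rhoOne (φ : ℝ → ℝ) (v : ℝ) : ℝ :=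
  (1 / v) * ∫ z, z * φ z ∂(gaussianReal 0 v.toNNReal)

/-- `ρ₂² = 𝔼 [φ(z)²] - v ρ₁²` for `z ∼ N(0, v)`. -/
def rhoTwoSq (φ : ℝ → ℝ) (v : ℝ) : ℝ :=
  (∫ z, φ z ^ 2 ∂(gaussianReal 0 v.toNNReal)) - v * rhoOne φ v ^ 2

section Network

variable (φ : ℝ → ℝ) (d : ℕ → ℕ) (W : (k : ℕ) → Matrix (Fin (d (k + 1))) (Fin (d k)) ℝ)

/-- The output `x⁽ˡ⁾` of the `l`-th hidden layer as a function of the input `x⁽⁰⁾ = x`: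
`x⁽ˡ⁺¹⁾ = φ(W⁽ˡ⁺¹⁾ x⁽ˡ⁾)` with `φ` acting entrywise. The matrix `W k` maps layer `k` to layer
`k + 1`, so it is the weight matrix `W⁽ᵏ⁺¹⁾`. -/
def layer : (l : ℕ) → EuclideanSpace ℝ (Fin (d 0)) → EuclideanSpace ℝ (Fin (d l))
  | 0 => fun x => x
  | l + 1 => fun x => WithLp.toLp 2 (fun i => φ ((W l *ᵥ (layer l x).ofLp) i))

variable (μ : Measure (EuclideanSpace ℝ (Fin (d 0))))

/-- `Σ_l = 𝔼 [x⁽ˡ⁾ x⁽ˡ⁾ᵀ]`, where `μ` is the law of the input. -/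
def layerCov (l : ℕ) : Matrix (Fin (d l)) (Fin (d l)) ℝ :=
  Matrix.of fun i j => ∫ x, layer φ d W l x i * layer φ d W l x j ∂μ

/-- `σ_l² = Tr(Σ_l) / d_l`. -/
def layerVar (l : ℕ) : ℝ := (layerCov φ d W μ l).trace / d l

/-- `ρ_{l+1,1}`, the linear coefficient of layer `l + 1`. -/
def layerRhoOne (l : ℕ) : ℝ := rhoOne φ (layerVar φ d W μ l)

/-- `ρ_{l+1,2}²`, the noise coefficient of layer `l + 1`. -/
def layerRhoTwoSq (l : ℕ) : ℝ := rhoTwoSq φ (layerVar φ d W μ l)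

/-- One step of the covariance recursion from layer `l` to layer `l + 1`:
`S ↦ ρ₁² W S Wᵀ + ρ₂² I`. -/
def covStep (l : ℕ) (S : Matrix (Fin (d l)) (Fin (d l)) ℝ) :
    Matrix (Fin (d (l + 1))) (Fin (d (l + 1))) ℝ :=
  layerRhoOne φ d W μ l ^ 2 • (W l * S * (W l)ᵀ) + layerRhoTwoSq φ d W μ l • 1

/-- `Σ̃_{l+1} = ρ₁² W Σ_l Wᵀ + ρ₂² I`, from the true covariance of the previous layer;
`Σ̃_0 = Σ_0`. -/
def equivCov : (l : ℕ) → Matrix (Fin (d l)) (Fin (d l)) ℝ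
  | 0 => layerCov φ d W μ 0
  | l + 1 => covStep φ d W μ l (layerCov φ d W μ l)

/-- The iterated approximation `S_{l+1} = ρ₁² W S_l Wᵀ + ρ₂² I`, `S_0 = Σ_0`, in which the
previous covariance is itself replaced by its approximation. -/
def iterCov : (l : ℕ) → Matrix (Fin (d l)) (Fin (d l)) ℝ
  | 0 => layerCov φ d W μ 0
  | l + 1 => covStep φ d W μ l (iterCov l)

end Network

end DeepRF

end

/-! Every scalar in play has size `d^{-1/2}`, so only the behaviour of `φ` near `0` matters. Since
`φ` is odd, `φ''(0) = 0`, hence `φ z = a z + O(|z|³)` with `a = φ'(0)`, and `φ u * φ v = a² u v +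
O(u⁴ + v⁴)`.

A preactivation `u_i` is a Lipschitz function of the input. Concentration bounds its fourth central
moment by `O(σ⁴) = O(d⁻²)`, and `exists_mean_bound` shows by induction on the layer that its mean is
`O(d^{-1/2})`. Hence `𝔼 u_i⁴ = O(d⁻²)` and `𝔼 [φ(u_i) φ(u_j)] = a² 𝔼 [u_i u_j] + O(d⁻²)`.

The Gaussian coefficients agree with this expansion: the layer variance is `v = O(1/d)`, so `ρ₁² =
a² + O(v)` multiplies `𝔼 [u_i u_j] = O(1/d)`, and `ρ₂² = O(v²)`. Each entry of `Σ_{l+1} - (ρ₁² W Σ_l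
Wᵀ + ρ₂² I)` is therefore `O(d⁻²)` (`exists_entry_bound`), and an `m × m` matrix with entries at
most `ε` has norm at most `m ε`, which gives `m / d²`. For the iterated recursion there is the extra
term `ρ₁² W (Σ_l - S_l) Wᵀ`, which produces the summand with `δ`. -/

namespace DeepRF

/-! ### Scalar estimates: Taylor expansion of the activation at the origin. -/

/-- `φ` is Lipschitz and has the linear approximation `a * z` with a remainder that is at most
linear and at most cubic. -/
structure CubicRemainder (φ : ℝ → ℝ) (a B : ℝ) : Prop where
  pos : 0 < B
  abs_le : |a| ≤ B
  lipschitz : LipschitzWith B.toNNReal φ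
  linear : ∀ z, |φ z - a * z| ≤ B * |z|
  cubic : ∀ z, |φ z - a * z| ≤ B * |z| ^ 3

theorem abs_le_mul_pow_succ_of_hasDerivAt {f f' : ℝ → ℝ} (hf : ∀ x, HasDerivAt f (f' x) x)
    (h0 : f 0 = 0) {B : ℝ} (k : ℕ) (hb : ∀ x, |f' x| ≤ B * |x| ^ k) (z : ℝ) :
    |f z| ≤ B * |z| ^ (k + 1) := by
  have hB : 0 ≤ B := by simpa using (abs_nonneg _).trans (hb 1)
  have h := (convex_Icc (-|z|) |z|).norm_image_sub_le_of_norm_hasDerivWithin_le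
    (f := f) (f' := f') (C := B * |z| ^ k) (x := 0) (y := z)
    (fun x _ => (hf x).hasDerivWithinAt)
    (fun x hx => (hb x).trans (by
      have := abs_le.2 hx
      gcongr))
    (by simp) (abs_le.1 le_rfl)
  simpa [h0, pow_succ, mul_assoc] using h

theorem Activation.hasDerivAt_iteratedDeriv {φ : ℝ → ℝ} (hφ : Activation φ) {k : ℕ} (hk : k < 5)
    (z : ℝ) : HasDerivAt (iteratedDeriv k φ) (iteratedDeriv (k + 1) φ z) z := by
  rw [iteratedDeriv_succ]
  exact (hφ.differentiable k hk z).hasDerivAt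

theorem Activation.exists_cubicRemainder {φ : ℝ → ℝ} (hφ : Activation φ) :
    ∃ a B : ℝ, CubicRemainder φ a B := by
  obtain ⟨B₁, h₁⟩ := hφ.bounded_one
  obtain ⟨B₃, h₃⟩ := hφ.bounded_three
  have hodd : (fun z => φ (-z)) = fun z => -φ z := funext hφ.odd
  have hz : φ 0 = 0 := by have := hφ.odd 0; simp at this; linarith
  -- Oddness removes the quadratic Taylor term; this is what makes the remainder cubic.
  have h2 : iteratedDeriv 2 φ 0 = 0 := by
    have h := iteratedDeriv_comp_neg 2 φ 0
    have h' := iteratedDeriv_neg 2 φ 0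
    rw [hodd] at h
    have h'' : iteratedDeriv 2 (fun z => -φ z) 0 = -iteratedDeriv 2 φ 0 := h'
    rw [h''] at h
    norm_num at h
    linarith
  have hB₁ : 0 ≤ B₁ := (abs_nonneg _).trans (h₁ 0)
  have hB₃ : 0 ≤ B₃ := (abs_nonneg _).trans (h₃ 0)
  set a := iteratedDeriv 1 φ 0 with ha
  have hφ' : ∀ z, HasDerivAt φ (iteratedDeriv 1 φ z) z := by
    simpa using hφ.hasDerivAt_iteratedDeriv (k := 0) (by norm_num)
  have hr : ∀ z, HasDerivAt (fun z => φ z - a * z) (iteratedDeriv 1 φ z - a) z := fun z => by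
    have := (hφ' z).sub ((hasDerivAt_id z).const_mul a)
    rw [mul_one] at this
    exact this
  have hr' : ∀ z, HasDerivAt (fun z => iteratedDeriv 1 φ z - a) (iteratedDeriv 2 φ z) z :=
    fun z => (hφ.hasDerivAt_iteratedDeriv (k := 1) (by norm_num) z).sub_const a
  have b2 := abs_le_mul_pow_succ_of_hasDerivAt
    (hφ.hasDerivAt_iteratedDeriv (k := 2) (by norm_num)) h2 0 (B := B₃) (by simpa using h₃)
  have b1 := abs_le_mul_pow_succ_of_hasDerivAt hr' (by simp [ha]) 1 b2
  have b0 := abs_le_mul_pow_succ_of_hasDerivAt hr (by simp [hz]) 2 b1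
  have l0 := abs_le_mul_pow_succ_of_hasDerivAt hr (by simp [hz]) 0 (B := 2 * B₁) (fun z => by
    have := abs_sub (iteratedDeriv 1 φ z) a
    have := h₁ z
    have := h₁ 0
    simp only [pow_zero, mul_one]
    linarith)
  -- One constant serves all fields: `1` for positivity, `2 * B₁` for `|φ' - φ'(0)|`, `B₃` for three
  -- integrations of `φ'''`, with the factorials discarded.
  refine ⟨a, 1 + 2 * B₁ + B₃, by positivity, by linarith [h₁ 0], ?_, fun z => ?_, fun z => ?_⟩
  · rw [← lipschitzOnWith_univ]
    refine Convex.lipschitzOnWith_of_nnnorm_hasDerivWithin_le convex_univ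
      (fun x _ => (hφ' x).hasDerivWithinAt) (fun x _ => ?_)
    rw [← NNReal.coe_le_coe, Real.coe_toNNReal _ (by positivity)]
    exact (h₁ x).trans (by linarith)
  · refine (l0 z).trans ?_
    simp only [zero_add, pow_one]
    gcongr
    linarith
  · refine (b0 z).trans ?_
    gcongr
    linarith

/-- Interpolates between the cubic bound for `|z| ≤ 1` and the linear one for `|z| ≥ 1`. It lets
means be controlled by second moments. -/
theorem CubicRemainder.abs_sub_le_sq {φ : ℝ → ℝ} {a B : ℝ} (h : CubicRemainder φ a B)
    (z : ℝ) : |φ z - a * z| ≤ B * z ^ 2 := by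
  have hB := h.pos
  rw [← sq_abs]
  rcases le_total |z| 1 with hz | hz
  · refine (h.cubic z).trans ?_
    exact mul_le_mul_of_nonneg_left (pow_le_pow_of_le_one (abs_nonneg _) hz (by norm_num)) hB.le
  · refine (h.linear z).trans (mul_le_mul_of_nonneg_left ?_ hB.le)
    exact le_self_pow₀ hz (by norm_num)

/-- In the product of the two remainders one factor takes the linear bound and the other the cubic
one, so the total degree stays four and fourth moments suffice. -/
theorem CubicRemainder.abs_mul_sub_le {φ : ℝ → ℝ} {a B : ℝ} (h : CubicRemainder φ a B)
    (u v : ℝ) :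
    |φ u * φ v - a ^ 2 * (u * v)| ≤ 3 * B ^ 2 * (u ^ 4 + v ^ 4) := by
  have hB := h.pos
  have key : ∀ x y : ℝ, 0 ≤ x → 0 ≤ y → x * y ^ 3 ≤ x ^ 4 + y ^ 4 := fun x y hx hy => by
    rcases le_total x y with hxy | hxy
    · nlinarith [mul_le_mul_of_nonneg_right hxy (pow_nonneg hy 3), pow_nonneg hx 4]
    · nlinarith [mul_le_mul_of_nonneg_left (pow_le_pow_left₀ hy hxy 3) hx, pow_nonneg hy 4]
  have e4 : ∀ x : ℝ, |x| ^ 4 = x ^ 4 := fun x => (by decide : Even 4).pow_abs x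
  have k1 := key |u| |v| (abs_nonneg _) (abs_nonneg _)
  have k2 := key |v| |u| (abs_nonneg _) (abs_nonneg _)
  rw [e4, e4] at k1 k2
  have t1 : |a * u * (φ v - a * v)| ≤ B ^ 2 * (|u| * |v| ^ 3) := by
    rw [abs_mul, abs_mul]
    calc |a| * |u| * |φ v - a * v| ≤ B * |u| * (B * |v| ^ 3) := by
          gcongr
          exacts [h.abs_le, h.cubic v]
      _ = _ := by ring
  have t2 : |a * v * (φ u - a * u)| ≤ B ^ 2 * (|v| * |u| ^ 3) := by
    rw [abs_mul, abs_mul]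
    calc |a| * |v| * |φ u - a * u| ≤ B * |v| * (B * |u| ^ 3) := by
          gcongr
          exacts [h.abs_le, h.cubic u]
      _ = _ := by ring
  have t3 : |(φ u - a * u) * (φ v - a * v)| ≤ B ^ 2 * (|u| * |v| ^ 3) := by
    rw [abs_mul]
    calc |φ u - a * u| * |φ v - a * v| ≤ (B * |u|) * (B * |v| ^ 3) := by
          gcongr
          exacts [h.linear u, h.cubic v]
      _ = _ := by ring
  have e : φ u * φ v - a ^ 2 * (u * v) =
      a * u * (φ v - a * v) + a * v * (φ u - a * u) + (φ u - a * u) * (φ v - a * v) := by ring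
  rw [e]
  refine (abs_add_three _ _ _).trans ?_
  nlinarith [mul_le_mul_of_nonneg_left k1 (sq_nonneg B), mul_le_mul_of_nonneg_left k2 (sq_nonneg B)]

theorem CubicRemainder.abs_id_mul_sub_le {φ : ℝ → ℝ} {a B : ℝ} (h : CubicRemainder φ a B)
    (z : ℝ) : |z * φ z - a * z ^ 2| ≤ B * z ^ 4 := by
  have e : z * φ z - a * z ^ 2 = z * (φ z - a * z) := by ring
  have e4 : |z| ^ 4 = z ^ 4 := (by decide : Even 4).pow_abs z
  rw [e, abs_mul, ← e4]
  calc |z| * |φ z - a * z| ≤ |z| * (B * |z| ^ 3) := by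
        gcongr
        exact h.cubic z
    _ = _ := by ring

theorem CubicRemainder.continuous {φ : ℝ → ℝ} {a B : ℝ} (h : CubicRemainder φ a B)
    : Continuous φ := h.lipschitz.continuous

theorem CubicRemainder.abs_le_two_mul {φ : ℝ → ℝ} {a B : ℝ} (h : CubicRemainder φ a B)
    (z : ℝ) : |φ z| ≤ 2 * B * |z| := by
  have h1 := h.linear z
  have h2 : |a * z| ≤ B * |z| := by
    rw [abs_mul]
    exact mul_le_mul_of_nonneg_right h.abs_le (abs_nonneg _)
  have h3 := abs_add_le (φ z - a * z) (a * z)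
  rw [sub_add_cancel] at h3
  linarith

/-! ### Operator norms, rows and inner products. -/

theorem l2_opNorm_le_card_mul {m : ℕ} (E : Matrix (Fin m) (Fin m) ℝ) {ε : ℝ} (hε : 0 ≤ ε)
    (h : ∀ i j, |E i j| ≤ ε) : ‖E‖ ≤ m * ε := by
  rw [Matrix.l2_opNorm_def]
  refine ContinuousLinearMap.opNorm_le_bound _ (by positivity) fun x => ?_
  have hx : ∀ i, |(E *ᵥ x.ofLp) i| ≤ Real.sqrt m * ε * ‖x‖ := fun i => by
    have h1 : (E *ᵥ x.ofLp) i = inner ℝ (WithLp.toLp 2 (E i)) x := by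
      simp [Matrix.mulVec, dotProduct, PiLp.inner_apply, mul_comm]
    rw [h1]
    refine (abs_real_inner_le_norm _ _).trans (mul_le_mul_of_nonneg_right ?_ (norm_nonneg _))
    rw [EuclideanSpace.norm_eq, ← Real.sqrt_sq hε, ← Real.sqrt_mul (by positivity)]
    refine Real.sqrt_le_sqrt ?_
    refine (Finset.sum_le_sum (g := fun _ => ε ^ 2) fun j _ => ?_).trans (by simp)
    exact pow_le_pow_left₀ (norm_nonneg _) (h i j) 2
  have : ‖(WithLp.toLp 2 (E *ᵥ x.ofLp) : EuclideanSpace ℝ (Fin m))‖ ≤ m * ε * ‖x‖ := by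
    rw [EuclideanSpace.norm_eq]
    refine Real.sqrt_le_iff.2 ⟨by positivity, ?_⟩
    refine (Finset.sum_le_sum (g := fun _ => (Real.sqrt m * ε * ‖x‖) ^ 2) fun i _ =>
      pow_le_pow_left₀ (norm_nonneg _) (hx i) 2).trans (le_of_eq ?_)
    simp only [Finset.sum_const, Finset.card_univ, Fintype.card_fin, nsmul_eq_mul, mul_pow,
      Real.sq_sqrt (Nat.cast_nonneg m)]
    ring
  exact this

theorem norm_row_le {m n : ℕ} (W : Matrix (Fin m) (Fin n) ℝ) (i : Fin m) :
    ‖(WithLp.toLp 2 (W i) : EuclideanSpace ℝ (Fin n))‖ ≤ ‖W‖ := by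
  have h := Matrix.l2_opNorm_mulVec Wᴴ (EuclideanSpace.single i (1 : ℝ))
  have e : Wᴴ *ᵥ (EuclideanSpace.single i (1 : ℝ)).ofLp = W i := by
    ext j
    simp
  rw [e, Matrix.l2_opNorm_conjTranspose] at h
  simpa using h

theorem mulVec_apply_eq_inner {m n : ℕ} (W : Matrix (Fin m) (Fin n) ℝ)
    (x : EuclideanSpace ℝ (Fin n)) (i : Fin m) :
    (W *ᵥ x.ofLp) i = inner ℝ (WithLp.toLp 2 (W i)) x := by
  simp [Matrix.mulVec, dotProduct, PiLp.inner_apply, mul_comm]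

theorem inner_mulVec {m n : ℕ} (W : Matrix (Fin m) (Fin n) ℝ)
    (w : EuclideanSpace ℝ (Fin m)) (x : EuclideanSpace ℝ (Fin n)) :
    ∑ i, w i * (W *ᵥ x.ofLp) i = inner ℝ (WithLp.toLp 2 (Wᴴ *ᵥ w.ofLp)) x := by
  have : ∑ i, w i * (W *ᵥ x.ofLp) i = w.ofLp ⬝ᵥ W *ᵥ x.ofLp := rfl
  rw [this, Matrix.dotProduct_mulVec, ← Matrix.mulVec_transpose]
  simp [dotProduct, PiLp.inner_apply, mul_comm]

theorem sum_abs_le_sqrt_mul_norm {m : ℕ} (w : EuclideanSpace ℝ (Fin m)) :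
    ∑ i, |w i| ≤ Real.sqrt m * ‖w‖ := by
  rw [EuclideanSpace.norm_eq, ← Real.sqrt_mul (Nat.cast_nonneg m)]
  refine Real.le_sqrt_of_sq_le ?_
  simpa using sq_sum_le_card_mul_sum_sq (s := Finset.univ) (f := fun i => |w i|)


/-! ### Fourth moments from Lipschitz concentration. -/

/-- Layer-cake formula: `4 ∫ t³ * 2 exp(-b t²) dt = 4 / b²` over `t > 0`, with `b = 1 / (2 K² σ²)`.
The lower Lebesgue integral is used because integrability is a consequence, not an assumption. -/
theorem LCP.lintegral_pow_four_le {n : ℕ} {μ : Measure (EuclideanSpace ℝ (Fin n))}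
    [IsProbabilityMeasure μ] {σ : ℝ} (h : LCP μ σ) {K : ℝ≥0} (hK : 0 < K)
    {f : EuclideanSpace ℝ (Fin n) → ℝ} (hf : LipschitzWith K f) :
    ∫⁻ x, ENNReal.ofReal (|f x - ∫ y, f y ∂μ| ^ 4) ∂μ ≤
      ENNReal.ofReal (16 * (K : ℝ) ^ 4 * σ ^ 4) := by
  obtain ⟨hσ, hc⟩ := h
  set c := ∫ y, f y ∂μ
  have hK' : (0 : ℝ) < K := hK
  set b : ℝ := 1 / (2 * (K : ℝ) ^ 2 * σ ^ 2) with hb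
  have hb0 : 0 < b := by positivity
  have hm : Measurable fun x => |f x - c| := (hf.continuous.sub continuous_const).abs.measurable
  have key := lintegral_rpow_eq_lintegral_meas_le_mul μ
    (Filter.Eventually.of_forall fun x => abs_nonneg (f x - c)) hm.aemeasurable
    (p := 4) (by norm_num)
  have e4 : ∀ x, |f x - c| ^ (4 : ℝ) = |f x - c| ^ 4 := fun x => by
    rw [← Real.rpow_natCast]; norm_num
  simp only [e4] at key
  rw [key]
  have hint := integrableOn_rpow_mul_exp_neg_mul_rpow (p := 2) (s := 3) (b := b)
    (by norm_num) (by norm_num) hb0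
  have hval := integral_rpow_mul_exp_neg_mul_rpow (p := 2) (q := 3) (b := b)
    (by norm_num) (by norm_num) hb0
  have step : ∫⁻ t in Set.Ioi (0 : ℝ), μ {x | t ≤ |f x - c|} * ENNReal.ofReal (t ^ ((4 : ℝ) - 1)) ≤
      ∫⁻ t in Set.Ioi (0 : ℝ), ENNReal.ofReal (2 * (t ^ (3 : ℝ) * Real.exp (-b * t ^ (2 : ℝ)))) := by
    refine setLIntegral_mono' measurableSet_Ioi fun t ht => ?_
    have ht' : (0 : ℝ) < t := ht
    rw [← ofReal_measureReal (measure_ne_top μ _), ← ENNReal.ofReal_mul measureReal_nonneg]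
    refine ENNReal.ofReal_le_ofReal ?_
    have h3 : ((4 : ℝ) - 1) = 3 := by norm_num
    have e : -t ^ 2 / (2 * (K : ℝ) ^ 2 * σ ^ 2) = -b * t ^ (2 : ℝ) := by
      rw [hb, Real.rpow_two]; ring
    have := hc K f hf t ht'
    rw [e] at this
    rw [h3]
    calc _ ≤ 2 * Real.exp (-b * t ^ (2 : ℝ)) * t ^ (3 : ℝ) :=
          mul_le_mul_of_nonneg_right this (by positivity)
      _ = _ := by ring
  refine (mul_le_mul_right step _).trans ?_
  rw [← ofReal_integral_eq_lintegral_ofReal (hint.const_mul 2)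
    ((ae_restrict_mem measurableSet_Ioi).mono fun t ht => by
      have ht' : (0 : ℝ) < t := ht
      positivity), ← ENNReal.ofReal_mul (by norm_num), integral_const_mul, hval]
  refine ENNReal.ofReal_le_ofReal (le_of_eq ?_)
  have g2 : Real.Gamma ((3 + 1) / 2) = 1 := by
    rw [show ((3 : ℝ) + 1) / 2 = 2 by norm_num, Real.Gamma_two]
  have bp : b ^ (-((3 : ℝ) + 1) / 2) = 4 * (K : ℝ) ^ 4 * σ ^ 4 := by
    rw [show -((3 : ℝ) + 1) / 2 = -((2 : ℕ) : ℝ) by norm_num, Real.rpow_neg hb0.le,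
      Real.rpow_natCast, hb]
    field_simp
    norm_num
  rw [g2, bp]
  ring

theorem LCP.integrable_sub_integral_pow_four {n : ℕ} {μ : Measure (EuclideanSpace ℝ (Fin n))}
    [IsProbabilityMeasure μ] {σ : ℝ} (h : LCP μ σ) {K : ℝ≥0} (hK : 0 < K)
    {f : EuclideanSpace ℝ (Fin n) → ℝ} (hf : LipschitzWith K f) :
    Integrable (fun x => (f x - ∫ y, f y ∂μ) ^ 4) μ ∧
      ∫ x, (f x - ∫ y, f y ∂μ) ^ 4 ∂μ ≤ 16 * (K : ℝ) ^ 4 * σ ^ 4 := by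
  have hl := h.lintegral_pow_four_le hK hf
  simp only [(by decide : Even 4).pow_abs] at hl
  have hm : Continuous fun x => (f x - ∫ y, f y ∂μ) ^ 4 :=
    (hf.continuous.sub continuous_const).pow 4
  have hnn : ∀ x, 0 ≤ (f x - ∫ y, f y ∂μ) ^ 4 := fun x => (by decide : Even 4).pow_nonneg _
  have hi : Integrable (fun x => (f x - ∫ y, f y ∂μ) ^ 4) μ := by
    refine ⟨hm.aestronglyMeasurable, ?_⟩
    rw [hasFiniteIntegral_iff_ofReal (Filter.Eventually.of_forall hnn)]
    exact hl.trans_lt ENNReal.ofReal_lt_top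
  refine ⟨hi, ?_⟩
  rw [← ofReal_integral_eq_lintegral_ofReal hi (Filter.Eventually.of_forall hnn)] at hl
  exact (ENNReal.ofReal_le_ofReal_iff (by positivity)).1 hl

theorem LCP.integrable_pow_four {n : ℕ} {μ : Measure (EuclideanSpace ℝ (Fin n))}
    [IsProbabilityMeasure μ] {σ : ℝ} (h : LCP μ σ) {K : ℝ≥0} (hK : 0 < K)
    {f : EuclideanSpace ℝ (Fin n) → ℝ} (hf : LipschitzWith K f) :
    Integrable (fun x => f x ^ 4) μ ∧
      ∫ x, f x ^ 4 ∂μ ≤ 8 * (16 * (K : ℝ) ^ 4 * σ ^ 4 + (∫ x, f x ∂μ) ^ 4) := by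
  obtain ⟨hi, hle⟩ := h.integrable_sub_integral_pow_four hK hf
  set c := ∫ y, f y ∂μ
  -- Convexity: `(s + t)⁴ ≤ 8 (s⁴ + t⁴)`.
  have hp : ∀ x, f x ^ 4 ≤ 8 * ((f x - c) ^ 4 + c ^ 4) := fun x => by
    nlinarith [sq_nonneg (f x - c - c), sq_nonneg (f x - c + c), sq_nonneg ((f x - c) ^ 2 - c ^ 2),
      mul_nonneg (sq_nonneg (f x - c - c)) (sq_nonneg (f x - c + c)),
      mul_nonneg (sq_nonneg (f x - c - c)) (sq_nonneg (f x - c)),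
      mul_nonneg (sq_nonneg (f x - c - c)) (sq_nonneg c)]
  have hi' : Integrable (fun x => 8 * ((f x - c) ^ 4 + c ^ 4)) μ :=
    (hi.add (integrable_const _)).const_mul 8
  refine ⟨hi'.mono' (hf.continuous.pow 4).aestronglyMeasurable
    (Filter.Eventually.of_forall fun x => ?_), ?_⟩
  · rw [Real.norm_eq_abs, abs_of_nonneg ((by decide : Even 4).pow_nonneg _)]
    exact hp x
  · refine (integral_mono_of_nonneg
      (Filter.Eventually.of_forall fun x => (by decide : Even 4).pow_nonneg _) hi'
      (Filter.Eventually.of_forall hp)).trans ?_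
    rw [integral_const_mul, integral_add hi (integrable_const _)]
    simp only [integral_const, probReal_univ, one_smul]
    linarith


theorem integrable_of_abs_le_pow_four {Ω : Type*} [MeasurableSpace Ω] {μ : Measure Ω}
    [IsFiniteMeasure μ] {u v g : Ω → ℝ} (hu : Integrable (fun x => u x ^ 4) μ)
    (hv : Integrable (fun x => v x ^ 4) μ) (hg : AEStronglyMeasurable g μ) (C : ℝ)
    (h : ∀ x, |g x| ≤ C * (1 + u x ^ 4 + v x ^ 4)) : Integrable g μ :=
  ((((integrable_const (1 : ℝ)).add hu).add hv).const_mul C).mono' hg (Filter.Eventually.of_forall h)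

theorem abs_mul_le_one_add_pow_four (u v : ℝ) : |u * v| ≤ 1 * (1 + u ^ 4 + v ^ 4) := by
  rw [abs_le]
  constructor <;>
  nlinarith [sq_nonneg (u ^ 2 - 1 / 2), sq_nonneg (v ^ 2 - 1 / 2), sq_nonneg (u - v),
    sq_nonneg (u + v)]

/-! ### Size of the Gaussian coefficients `ρ₁` and `ρ₂²` for small variance. -/

/-- The fourth moment of the standard normal distribution. -/
noncomputable def gaussianFourth : ℝ := ∫ z, z ^ 4 ∂(gaussianReal 0 1)

theorem gaussianFourth_nonneg : 0 ≤ gaussianFourth :=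
  integral_nonneg fun z => (by decide : Even 4).pow_nonneg z

theorem integrable_pow_gaussianReal (v : ℝ≥0) {k : ℕ} (hk : Even k) :
    Integrable (fun z : ℝ => z ^ k) (gaussianReal 0 v) := by
  have h := (memLp_id_gaussianReal (μ := 0) (v := v) (k : ℝ≥0)).integrable_norm_pow'
  simpa [hk.pow_abs] using h

/-- Only the scaling in `v` is needed; the numerical value of `gaussianFourth` plays no role. -/
theorem integral_pow_four_gaussianReal (v : ℝ≥0) :
    ∫ z, z ^ 4 ∂(gaussianReal 0 v) = (v : ℝ) ^ 2 * gaussianFourth := by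
  have h := gaussianReal_map_const_mul (μ := 0) (v := 1) (Real.sqrt v)
  have e : NNReal.mk (Real.sqrt v ^ 2) (sq_nonneg _) * 1 = v := by
    ext
    simp
  rw [mul_zero, e] at h
  rw [← h, integral_map (by fun_prop) (by fun_prop), gaussianFourth, ← integral_const_mul]
  congr 1
  ext z
  have : Real.sqrt v ^ 2 = v := Real.sq_sqrt v.2
  calc (Real.sqrt v * z) ^ 4 = (Real.sqrt v ^ 2) ^ 2 * z ^ 4 := by ring
    _ = _ := by rw [this]

theorem integral_sq_gaussianReal (v : ℝ≥0) : ∫ z, z ^ 2 ∂(gaussianReal 0 v) = v := by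
  have h := variance_fun_id_gaussianReal (μ := 0) (v := v)
  rw [variance_eq_integral (by fun_prop)] at h
  simpa [integral_id_gaussianReal] using h

/-- `𝔼 [z φ(z)] = a v + O(v²)`, divided by `v`. At `v = 0` the convention `1 / 0 = 0` makes `rhoOne`
vanish, so positivity of `v` is essential. -/
theorem CubicRemainder.abs_rhoOne_sub_le {φ : ℝ → ℝ} {a B : ℝ} (h : CubicRemainder φ a B)
    {v : ℝ} (hv : 0 < v) : |rhoOne φ v - a| ≤ B * gaussianFourth * v := by
  have hφ := h.continuous
  have i2 := integrable_pow_gaussianReal v.toNNReal (k := 2) (by decide)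
  have i4 := integrable_pow_gaussianReal v.toNNReal (k := 4) (by decide)
  have i1 : Integrable (fun z => z * φ z) (gaussianReal 0 v.toNNReal) := by
    refine (i2.const_mul (2 * B)).mono' (by fun_prop) (Filter.Eventually.of_forall fun z => ?_)
    rw [Real.norm_eq_abs, abs_mul, ← sq_abs z]
    nlinarith [mul_le_mul_of_nonneg_left (h.abs_le_two_mul z) (abs_nonneg z)]
  have key : |∫ z, (z * φ z - a * z ^ 2) ∂(gaussianReal 0 v.toNNReal)| ≤
      B * (v ^ 2 * gaussianFourth) := by
    refine (abs_integral_le_integral_abs).trans ?_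
    refine (integral_mono_of_nonneg (Filter.Eventually.of_forall fun _ => abs_nonneg _)
      (i4.const_mul B) (Filter.Eventually.of_forall h.abs_id_mul_sub_le)).trans (le_of_eq ?_)
    rw [integral_const_mul, integral_pow_four_gaussianReal, Real.coe_toNNReal _ hv.le]
  rw [integral_sub i1 (i2.const_mul a), integral_const_mul, integral_sq_gaussianReal,
    Real.coe_toNNReal _ hv.le] at key
  have e : rhoOne φ v - a = (1 / v) * ((∫ z, z * φ z ∂(gaussianReal 0 v.toNNReal)) - a * v) := by
    rw [rhoOne]
    field_simp
  rw [e, abs_mul, abs_of_pos (by positivity : 0 < 1 / v)]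
  calc _ ≤ 1 / v * (B * (v ^ 2 * gaussianFourth)) := by gcongr
    _ = _ := by field_simp

theorem CubicRemainder.abs_rhoOne_le {φ : ℝ → ℝ} {a B : ℝ} (h : CubicRemainder φ a B)
    {v : ℝ} (hv : 0 < v) : |rhoOne φ v| ≤ 2 * B := by
  have i2 := integrable_pow_gaussianReal v.toNNReal (k := 2) (by decide)
  have key : |∫ z, z * φ z ∂(gaussianReal 0 v.toNNReal)| ≤ 2 * B * v := by
    refine (abs_integral_le_integral_abs).trans ?_
    refine (integral_mono_of_nonneg (Filter.Eventually.of_forall fun _ => abs_nonneg _)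
      (i2.const_mul (2 * B)) (Filter.Eventually.of_forall fun z => ?_)).trans (le_of_eq ?_)
    · simp only [abs_mul]
      rw [← sq_abs z]
      nlinarith [mul_le_mul_of_nonneg_left (h.abs_le_two_mul z) (abs_nonneg z)]
    · rw [integral_const_mul, integral_sq_gaussianReal, Real.coe_toNNReal _ hv.le]
  rw [rhoOne, abs_mul, abs_of_pos (by positivity : 0 < 1 / v)]
  calc _ ≤ 1 / v * (2 * B * v) := by gcongr
    _ = _ := by field_simp

theorem CubicRemainder.abs_rhoOne_sq_sub_le {φ : ℝ → ℝ} {a B : ℝ} (h : CubicRemainder φ a B)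
    {v : ℝ} (hv : 0 < v) : |rhoOne φ v ^ 2 - a ^ 2| ≤ 3 * B ^ 2 * gaussianFourth * v := by
  have hB := h.pos
  have hG := gaussianFourth_nonneg
  have h1 : |rhoOne φ v + a| ≤ 3 * B := by
    have := abs_add_le (rhoOne φ v) a
    linarith [h.abs_rhoOne_le hv, h.abs_le]
  rw [sq_sub_sq, abs_mul]
  calc _ ≤ 3 * B * (B * gaussianFourth * v) := by
        gcongr
        exact h.abs_rhoOne_sub_le hv
    _ = _ := by ring

theorem CubicRemainder.abs_rhoTwoSq_le {φ : ℝ → ℝ} {a B : ℝ} (h : CubicRemainder φ a B)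
    {v : ℝ} (hv : 0 ≤ v) : |rhoTwoSq φ v| ≤ 9 * B ^ 2 * gaussianFourth * v ^ 2 := by
  have hφ := h.continuous
  rcases hv.eq_or_lt with rfl | hv
  · have : φ 0 = 0 := by simpa using h.linear 0
    simp [rhoTwoSq, gaussianReal_zero_var, this]
  have i2 := integrable_pow_gaussianReal v.toNNReal (k := 2) (by decide)
  have i4 := integrable_pow_gaussianReal v.toNNReal (k := 4) (by decide)
  have i1 : Integrable (fun z => φ z ^ 2) (gaussianReal 0 v.toNNReal) := by
    refine (i2.const_mul ((2 * B) ^ 2)).mono' (by fun_prop)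
      (Filter.Eventually.of_forall fun z => ?_)
    rw [Real.norm_eq_abs, abs_pow, ← sq_abs z, ← mul_pow]
    exact pow_le_pow_left₀ (abs_nonneg _) (h.abs_le_two_mul z) 2
  have key : |∫ z, (φ z ^ 2 - a ^ 2 * z ^ 2) ∂(gaussianReal 0 v.toNNReal)| ≤
      6 * B ^ 2 * (v ^ 2 * gaussianFourth) := by
    refine (abs_integral_le_integral_abs).trans ?_
    refine (integral_mono_of_nonneg (Filter.Eventually.of_forall fun _ => abs_nonneg _)
      (i4.const_mul (6 * B ^ 2)) (Filter.Eventually.of_forall fun z => ?_)).trans (le_of_eq ?_)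
    · have := h.abs_mul_sub_le z z
      rw [← sq, ← sq] at this
      exact this.trans (le_of_eq (by ring))
    · rw [integral_const_mul, integral_pow_four_gaussianReal, Real.coe_toNNReal _ hv.le]
  rw [integral_sub i1 (i2.const_mul _), integral_const_mul, integral_sq_gaussianReal,
    Real.coe_toNNReal _ hv.le] at key
  -- The leading terms `a² v` cancel. The two brackets contribute `6` and `3` to the constant `9`.
  have e : rhoTwoSq φ v = ((∫ z, φ z ^ 2 ∂(gaussianReal 0 v.toNNReal)) - a ^ 2 * v) -
      v * (rhoOne φ v ^ 2 - a ^ 2) := by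
    rw [rhoTwoSq]
    ring
  rw [e]
  refine (abs_sub _ _).trans ?_
  rw [abs_mul, abs_of_pos hv]
  nlinarith [mul_le_mul_of_nonneg_left (h.abs_rhoOne_sq_sub_le hv) hv.le]


/-! ### Lipschitz constants, moments and means of the layers. -/

/-- The part of the data of a deep random features model that the covariance estimates use. -/
structure Admissible (L : ℕ) (c K γ : ℝ) (d : ℕ → ℕ)
    (W : (k : ℕ) → Matrix (Fin (d (k + 1))) (Fin (d k)) ℝ)
    (μ : Measure (EuclideanSpace ℝ (Fin (d 0)))) : Prop where
  pos : ∀ k ≤ L, 0 < d k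
  dim_le : ∀ k ≤ L, (d k : ℝ) ≤ γ * d 0
  concentration : ∃ σ : ℝ, σ ^ 2 ≤ c / d 0 ∧ LCP μ σ
  mean : ∫ x, x ∂μ = 0
  norm_le : ∀ k < L, ‖W k‖ ≤ K

section

variable {φ : ℝ → ℝ} {a B : ℝ} {L : ℕ} {c K γ : ℝ} {d : ℕ → ℕ}
  {W : (k : ℕ) → Matrix (Fin (d (k + 1))) (Fin (d k)) ℝ}
  {μ : Measure (EuclideanSpace ℝ (Fin (d 0)))}

theorem lipschitzWith_layer (h : CubicRemainder φ a B) (hK : 0 < K) (hW : ∀ k < L, ‖W k‖ ≤ K) :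
    ∀ l ≤ L, LipschitzWith (((B * K) ^ l).toNNReal) (layer φ d W l) := by
  have hB := h.pos
  intro l
  induction l with
  | zero => intro _; rw [pow_zero, Real.toNNReal_one]; exact LipschitzWith.id
  | succ l ih =>
    intro hl
    have ih := ih (by omega)
    refine LipschitzWith.of_dist_le_mul fun x y => ?_
    rw [Real.coe_toNNReal _ (by positivity)]
    have h1 := ih.dist_le_mul x y
    rw [Real.coe_toNNReal _ (by positivity), dist_eq_norm] at h1
    have h2 := Matrix.l2_opNorm_mulVec (W l) (layer φ d W l x - layer φ d W l y)
    have h3 : dist (layer φ d W (l + 1) x) (layer φ d W (l + 1) y) ≤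
        B * ‖(WithLp.toLp 2 (W l *ᵥ (layer φ d W l x - layer φ d W l y).ofLp) :
          EuclideanSpace ℝ (Fin (d (l + 1))))‖ := by
      rw [EuclideanSpace.dist_eq, EuclideanSpace.norm_eq]
      refine Real.sqrt_le_iff.2 ⟨by positivity, ?_⟩
      rw [mul_pow, Real.sq_sqrt (Finset.sum_nonneg fun _ _ => sq_nonneg _), Finset.mul_sum]
      refine Finset.sum_le_sum fun i _ => ?_
      rw [← mul_pow]
      refine pow_le_pow_left₀ dist_nonneg ?_ 2
      have := h.lipschitz.dist_le_mul ((W l *ᵥ (layer φ d W l x).ofLp) i)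
        ((W l *ᵥ (layer φ d W l y).ofLp) i)
      rw [Real.coe_toNNReal _ hB.le, dist_eq_norm ((W l *ᵥ _) i)] at this
      simpa [layer, Matrix.mulVec_sub] using this
    calc _ ≤ B * (‖W l‖ * ‖layer φ d W l x - layer φ d W l y‖) :=
          h3.trans (mul_le_mul_of_nonneg_left h2 hB.le)
      _ ≤ B * (K * ((B * K) ^ l * dist x y)) := by
          gcongr
          exact hW l (by omega)
      _ = _ := by ring

theorem lipschitzWith_inner_layer (h : CubicRemainder φ a B) (hK : 0 < K)
    (hW : ∀ k < L, ‖W k‖ ≤ K) {l : ℕ} (hl : l ≤ L) {R : ℝ}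
    (w : EuclideanSpace ℝ (Fin (d l))) (hw : ‖w‖ ≤ R) :
    LipschitzWith ((R * (B * K) ^ l).toNNReal) fun x => inner ℝ w (layer φ d W l x) := by
  have hB := h.pos
  have hR : 0 ≤ R := (norm_nonneg _).trans hw
  refine LipschitzWith.of_dist_le_mul fun x y => ?_
  have h1 := (lipschitzWith_layer h hK hW l hl).dist_le_mul x y
  rw [Real.coe_toNNReal _ (by positivity), dist_eq_norm] at h1
  rw [Real.coe_toNNReal _ (by positivity), Real.dist_eq, ← inner_sub_right, mul_assoc]
  exact (abs_real_inner_le_norm _ _).trans (by gcongr)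

theorem inner_layer_succ (l : ℕ) (w : EuclideanSpace ℝ (Fin (d (l + 1))))
    (x : EuclideanSpace ℝ (Fin (d 0))) :
    inner ℝ w (layer φ d W (l + 1) x) =
      ∑ i, w i * φ (inner ℝ (WithLp.toLp 2 (W l i)) (layer φ d W l x)) := by
  simp only [PiLp.inner_apply, layer, RCLike.inner_apply, conj_trivial, mul_comm]
  refine Finset.sum_congr rfl fun i _ => ?_
  rw [mulVec_apply_eq_inner]
  simp [PiLp.inner_apply, mul_comm]

/-- Fourth and second moments of a linear functional of a layer, given a bound on its mean. -/
theorem moments_inner_layer [IsProbabilityMeasure μ] (h : CubicRemainder φ a B) (hK : 0 < K)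
    (H : Admissible L c K γ d W μ) {l : ℕ} (hl : l ≤ L) {P R : ℝ} (hP : 0 ≤ P) (hR : 0 < R)
    (hmean : ∀ w : EuclideanSpace ℝ (Fin (d l)),
      |∫ x, inner ℝ w (layer φ d W l x) ∂μ| ≤ P * ‖w‖ / Real.sqrt (d 0))
    -- `Q` does not involve the dimensions, so callers can fix it before the network is given.
    {Q : ℝ} (hQ : Q = 8 * (16 * (R * (B * K) ^ l) ^ 4 * c ^ 2 + (P * R) ^ 4))
    (w : EuclideanSpace ℝ (Fin (d l))) (hw : ‖w‖ ≤ R) :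
    Integrable (fun x => inner ℝ w (layer φ d W l x) ^ 4) μ ∧
      ∫ x, inner ℝ w (layer φ d W l x) ^ 4 ∂μ ≤ Q / (d 0 : ℝ) ^ 2 ∧
      ∫ x, inner ℝ w (layer φ d W l x) ^ 2 ∂μ ≤ (Q + 1) / d 0 := by
  have hB := h.pos
  have hD : (0 : ℝ) < d 0 := by exact_mod_cast H.pos 0 (Nat.zero_le _)
  obtain ⟨σ, hσ, hc⟩ := H.concentration
  have hlip := lipschitzWith_inner_layer h hK H.norm_le hl w hw
  have hpos : 0 < R * (B * K) ^ l := by positivity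
  obtain ⟨hi, hle⟩ := hc.integrable_pow_four (Real.toNNReal_pos.2 hpos) hlip
  rw [Real.coe_toNNReal _ hpos.le] at hle
  have h4 : ∫ x, inner ℝ w (layer φ d W l x) ^ 4 ∂μ ≤ Q / (d 0 : ℝ) ^ 2 := by
    refine hle.trans ?_
    have hs : σ ^ 4 ≤ (c / d 0) ^ 2 := by
      rw [show σ ^ 4 = (σ ^ 2) ^ 2 by ring]
      exact pow_le_pow_left₀ (sq_nonneg _) hσ 2
    have hm : (∫ x, inner ℝ w (layer φ d W l x) ∂μ) ^ 4 ≤ (P * R / Real.sqrt (d 0)) ^ 4 := by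
      rw [← (by decide : Even 4).pow_abs]
      refine pow_le_pow_left₀ (abs_nonneg _) ((hmean w).trans ?_) 4
      gcongr
    have hsq : Real.sqrt (d 0) ^ 4 = (d 0 : ℝ) ^ 2 := by
      rw [show Real.sqrt (d 0) ^ 4 = (Real.sqrt (d 0) ^ 2) ^ 2 by ring, Real.sq_sqrt hD.le]
    rw [div_pow, hsq] at hm
    rw [div_pow] at hs
    have hs' := mul_le_mul_of_nonneg_left hs
      (by positivity : 0 ≤ 16 * (R * (B * K) ^ l) ^ 4)
    calc _ ≤ 8 * (16 * (R * (B * K) ^ l) ^ 4 * (c ^ 2 / (d 0 : ℝ) ^ 2) +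
          (P * R) ^ 4 / (d 0 : ℝ) ^ 2) := by gcongr
      _ = Q / (d 0 : ℝ) ^ 2 := by rw [hQ]; ring
  refine ⟨hi, h4, ?_⟩
  -- A weighted AM-GM inequality at the natural scale `y² ~ 1/d`, turning the fourth-moment bound
  -- into a second-moment bound of the right order.
  have hp : ∀ y : ℝ, y ^ 2 ≤ d 0 * y ^ 4 + 1 / d 0 := fun y => by
    have e : (d 0 : ℝ) * y ^ 4 + 1 / d 0 - y ^ 2 =
        ((d 0 * y ^ 2 - 1 / 2) ^ 2 + 3 / 4) / d 0 := by
      field_simp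
      ring
    have : 0 ≤ ((d 0 * y ^ 2 - 1 / 2) ^ 2 + 3 / 4) / (d 0 : ℝ) := by positivity
    linarith
  refine (integral_mono_of_nonneg (Filter.Eventually.of_forall fun _ => sq_nonneg _)
    ((hi.const_mul (d 0 : ℝ)).add (integrable_const (1 / (d 0 : ℝ))))
    (Filter.Eventually.of_forall fun x => hp _)).trans ?_
  simp only [Pi.add_apply]
  rw [integral_add (hi.const_mul _) (integrable_const _), integral_const_mul]
  simp only [integral_const, probReal_univ, one_smul]
  calc _ ≤ d 0 * (Q / (d 0 : ℝ) ^ 2) + 1 / d 0 := by gcongr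
    _ = _ := by field_simp

end

/-- The input law need not be symmetric, so deeper layers need not be centred. With `r z = φ z - a
z`, the mean of `⟨w, x⁽ˡ⁺¹⁾⟩` is `a` times that of `⟨Wᵀ w, x⁽ˡ⁾⟩`, covered by induction, plus `∑ w_i
𝔼 [r(u_i)]`. Each `𝔼 [r(u_i)]` is `O(1/d)`, and `∑ |w_i| ≤ √d_{l+1} ‖w‖` costs only a factor of
order `√d`. -/
theorem exists_mean_bound {φ : ℝ → ℝ} {a B : ℝ} (h : CubicRemainder φ a B) {L : ℕ} {c K γ : ℝ}
    (hK : 0 < K) (l : ℕ) :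
    ∃ P : ℝ, 0 ≤ P ∧ ∀ (d : ℕ → ℕ) (W : (k : ℕ) → Matrix (Fin (d (k + 1))) (Fin (d k)) ℝ)
      (μ : Measure (EuclideanSpace ℝ (Fin (d 0)))) [IsProbabilityMeasure μ],
      Admissible L c K γ d W μ → l ≤ L → ∀ w : EuclideanSpace ℝ (Fin (d l)),
        |∫ x, inner ℝ w (layer φ d W l x) ∂μ| ≤ P * ‖w‖ / Real.sqrt (d 0) := by
  have hB := h.pos
  induction l with
  | zero =>
    refine ⟨0, le_rfl, fun d W μ _ H _ w => ?_⟩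
    -- The Bochner integral of a non-integrable function is `0` by default, so `H.mean` is
    -- informative only once integrability is known; concentration of the norm supplies it.
    by_cases hi : Integrable (fun x : EuclideanSpace ℝ (Fin (d 0)) => x) μ
    · have := (innerSL ℝ w).integral_comp_comm hi
      rw [H.mean, map_zero] at this
      have e : ∫ x, inner ℝ w (layer φ d W 0 x) ∂μ = 0 := this
      simp [e]
    · exfalso
      apply hi
      obtain ⟨σ, -, hc⟩ := H.concentration
      have hn : LipschitzWith 1 (fun x : EuclideanSpace ℝ (Fin (d 0)) => ‖x‖) := lipschitzWith_one_norm
      obtain ⟨i4, -⟩ := hc.integrable_pow_four one_pos hn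
      have := integrable_of_abs_le_pow_four (g := fun x => ‖x‖) i4
        (integrable_const ((1 : ℝ) ^ 4)) continuous_norm.aestronglyMeasurable 1 fun x => by
          simpa using abs_mul_le_one_add_pow_four ‖x‖ 1
      exact (integrable_norm_iff continuous_id.aestronglyMeasurable).1 this
  | succ l ih =>
    obtain ⟨P, hP, ih⟩ := ih
    set Q : ℝ := 8 * (16 * (K * (B * K) ^ l) ^ 4 * c ^ 2 + (P * K) ^ 4) with hQ
    have hQ0 : 0 ≤ Q := by positivity
    refine ⟨B * P * K + Real.sqrt |γ| * (B * (Q + 1)), by positivity, fun d W μ _ H hl w => ?_⟩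
    have ih := ih d W μ H (by omega)
    have hD : (0 : ℝ) < d 0 := by exact_mod_cast H.pos 0 (Nat.zero_le _)
    set D := Real.sqrt (d 0) with hDdef
    have hD0 : 0 < D := Real.sqrt_pos.2 hD
    have hD2 : D ^ 2 = d 0 := Real.sq_sqrt hD.le
    set u : Fin (d (l + 1)) → EuclideanSpace ℝ (Fin (d 0)) → ℝ :=
      fun i x => inner ℝ (WithLp.toLp 2 (W l i)) (layer φ d W l x) with hu
    have hrow : ∀ i, ‖(WithLp.toLp 2 (W l i) : EuclideanSpace ℝ (Fin (d l)))‖ ≤ K := fun i =>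
      (norm_row_le (W l) i).trans (H.norm_le l (by omega))
    have huc : ∀ i, Continuous (u i) := fun i =>
      (lipschitzWith_inner_layer h hK H.norm_le (by omega : l ≤ L) _ (hrow i)).continuous
    have hmom := fun i => moments_inner_layer h hK H (by omega : l ≤ L) hP hK ih hQ _ (hrow i)
    have hu1 : ∀ i, Integrable (u i) μ := fun i =>
      integrable_of_abs_le_pow_four (hmom i).1 (integrable_const ((1 : ℝ) ^ 4))
        (huc i).aestronglyMeasurable 1 fun x => by
          simpa using abs_mul_le_one_add_pow_four (u i x) 1
    have hu2 : ∀ i, Integrable (fun x => u i x ^ 2) μ := fun i =>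
      integrable_of_abs_le_pow_four (hmom i).1 (hmom i).1
        ((huc i).pow 2).aestronglyMeasurable 1 fun x => by
          simpa [sq] using abs_mul_le_one_add_pow_four (u i x) (u i x)
    have hφ := h.continuous
    have hr : ∀ i, Integrable (fun x => φ (u i x) - a * u i x) μ := fun i =>
      ((hu2 i).const_mul B).mono'
        ((hφ.comp (huc i)).sub (continuous_const.mul (huc i))).aestronglyMeasurable
        (Filter.Eventually.of_forall fun x => h.abs_sub_le_sq _)
    have hrb : ∀ i, |∫ x, (φ (u i x) - a * u i x) ∂μ| ≤ B * ((Q + 1) / d 0) := fun i => by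
      refine abs_integral_le_integral_abs.trans ?_
      refine (integral_mono_of_nonneg (Filter.Eventually.of_forall fun _ => abs_nonneg _)
        ((hu2 i).const_mul B) (Filter.Eventually.of_forall fun x => h.abs_sub_le_sq _)).trans ?_
      rw [integral_const_mul]
      exact mul_le_mul_of_nonneg_left (hmom i).2.2 hB.le
    set w' : EuclideanSpace ℝ (Fin (d l)) := WithLp.toLp 2 ((W l)ᴴ *ᵥ w.ofLp) with hw'
    have hw'n : ‖w'‖ ≤ K * ‖w‖ := by
      have := Matrix.l2_opNorm_mulVec (W l)ᴴ w
      rw [Matrix.l2_opNorm_conjTranspose] at this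
      exact this.trans (mul_le_mul_of_nonneg_right (H.norm_le l (by omega)) (norm_nonneg _))
    have split : ∀ x, inner ℝ w (layer φ d W (l + 1) x) =
        a * inner ℝ w' (layer φ d W l x) + ∑ i, w i * (φ (u i x) - a * u i x) := fun x => by
      rw [inner_layer_succ, hw', ← inner_mulVec, Finset.mul_sum, ← Finset.sum_add_distrib]
      refine Finset.sum_congr rfl fun i _ => ?_
      rw [mulVec_apply_eq_inner]
      ring
    have hw'i : Integrable (fun x => inner ℝ w' (layer φ d W l x)) μ := by
      have : (fun x => inner ℝ w' (layer φ d W l x)) = fun x => ∑ i, w i * u i x := by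
        ext x
        rw [hw', ← inner_mulVec]
        simp only [mulVec_apply_eq_inner, hu]
      rw [this]
      exact integrable_finsetSum _ fun i _ => (hu1 i).const_mul _
    have eq : ∫ x, inner ℝ w (layer φ d W (l + 1) x) ∂μ =
        a * ∫ x, inner ℝ w' (layer φ d W l x) ∂μ +
          ∑ i, w i * ∫ x, (φ (u i x) - a * u i x) ∂μ := by
      simp only [split]
      rw [integral_add (hw'i.const_mul a)
        (integrable_finsetSum _ fun i _ => (hr i).const_mul _), integral_const_mul,
        integral_finsetSum _ fun i _ => (hr i).const_mul _]
      simp only [integral_const_mul]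
    rw [eq]
    have t1 : |a * ∫ x, inner ℝ w' (layer φ d W l x) ∂μ| ≤ B * (P * (K * ‖w‖) / D) := by
      rw [abs_mul]
      refine mul_le_mul h.abs_le ((ih w').trans ?_) (abs_nonneg _) hB.le
      gcongr
    have hdim : Real.sqrt (d (l + 1)) ≤ Real.sqrt |γ| * D := by
      rw [hDdef, ← Real.sqrt_mul (abs_nonneg _)]
      refine Real.sqrt_le_sqrt ((H.dim_le _ hl).trans ?_)
      exact mul_le_mul_of_nonneg_right (le_abs_self γ) hD.le
    have t2 : |∑ i, w i * ∫ x, (φ (u i x) - a * u i x) ∂μ| ≤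
        Real.sqrt |γ| * D * ‖w‖ * (B * ((Q + 1) / d 0)) := by
      refine (Finset.abs_sum_le_sum_abs _ _).trans ?_
      refine (Finset.sum_le_sum (g := fun i => |w i| * (B * ((Q + 1) / d 0)))
        fun i _ => ?_).trans ?_
      · rw [abs_mul]
        exact mul_le_mul_of_nonneg_left (hrb i) (abs_nonneg _)
      · rw [← Finset.sum_mul]
        refine mul_le_mul_of_nonneg_right ((sum_abs_le_sqrt_mul_norm w).trans ?_) (by positivity)
        gcongr
    refine (abs_add_le _ _).trans ((add_le_add t1 t2).trans (le_of_eq ?_))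
    rw [← hD2]
    field_simp


/-! ### Entrywise comparison of the covariances. -/

/-- Entrywise, one step of the covariance recursion is exact up to `O(d⁻²)`. -/
theorem exists_entry_bound {φ : ℝ → ℝ} {a B : ℝ} (h : CubicRemainder φ a B) {L : ℕ} {c K γ : ℝ}
    (hK : 0 < K) (l : ℕ) :
    ∃ M : ℝ, 0 ≤ M ∧ ∀ (d : ℕ → ℕ) (W : (k : ℕ) → Matrix (Fin (d (k + 1))) (Fin (d k)) ℝ)
      (μ : Measure (EuclideanSpace ℝ (Fin (d 0)))) [IsProbabilityMeasure μ],
      Admissible L c K γ d W μ → l < L → ∀ i j,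
        |(layerCov φ d W μ (l + 1) - covStep φ d W μ l (layerCov φ d W μ l)) i j| ≤
          M / (d 0 : ℝ) ^ 2 := by
  have hB := h.pos
  have hφ := h.continuous
  have hG := gaussianFourth_nonneg
  obtain ⟨P, hP, hmean⟩ := exists_mean_bound h (L := L) (c := c) (γ := γ) hK l
  -- `R` must bound both the rows of `W l` (norm at most `K`) and the coordinate vectors (norm `1`).
  set R : ℝ := max K 1 with hR
  have hR0 : 0 < R := lt_max_of_lt_left hK
  set Q : ℝ := 8 * (16 * (R * (B * K) ^ l) ^ 4 * c ^ 2 + (P * R) ^ 4) with hQ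
  have hQ0 : 0 ≤ Q := by positivity
  set G := gaussianFourth
  -- The three summands come from `hmain`, `hρ` and `hρ2` respectively.
  refine ⟨3 * B ^ 2 * (2 * Q) + 3 * B ^ 2 * G * (Q + 1) * (Q + 1) + 9 * B ^ 2 * G * (Q + 1) ^ 2,
    by positivity, fun d W μ _ H hl i j => ?_⟩
  have hmean := hmean d W μ H hl.le
  have hD : (0 : ℝ) < d 0 := by exact_mod_cast H.pos 0 (Nat.zero_le _)
  have hdl : (0 : ℝ) < d l := by exact_mod_cast H.pos l hl.le
  have hmom := fun w hw => moments_inner_layer h hK H hl.le hP hR0 hmean hQ w hw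
  have hcont : ∀ w : EuclideanSpace ℝ (Fin (d l)), Continuous fun x =>
      inner ℝ w (layer φ d W l x) := fun w =>
    (lipschitzWith_inner_layer h hK H.norm_le hl.le w le_rfl).continuous
  -- coordinates of the layer
  have hcoord : ∀ (k : Fin (d l)) x, layer φ d W l x k =
      inner ℝ (EuclideanSpace.single k (1 : ℝ)) (layer φ d W l x) := fun k x => by
    simp [EuclideanSpace.inner_single_left]
  have hxc : ∀ k, Continuous fun x => layer φ d W l x k := fun k => by
    simpa only [hcoord] using hcont (EuclideanSpace.single k (1 : ℝ))
  have hxm : ∀ k, Integrable (fun x => layer φ d W l x k ^ 4) μ ∧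
      ∫ x, layer φ d W l x k ^ 2 ∂μ ≤ (Q + 1) / d 0 := fun k => by
    have := hmom (EuclideanSpace.single k (1 : ℝ)) (by simp [hR])
    simp only [hcoord]
    exact ⟨this.1, this.2.2⟩
  have hxx : ∀ k k', Integrable (fun x => layer φ d W l x k * layer φ d W l x k') μ :=
    fun k k' => integrable_of_abs_le_pow_four (hxm k).1 (hxm k').1
      ((hxc k).mul (hxc k')).aestronglyMeasurable 1 fun x => abs_mul_le_one_add_pow_four _ _
  -- preactivations
  set u : Fin (d (l + 1)) → EuclideanSpace ℝ (Fin (d 0)) → ℝ :=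
    fun i x => (W l *ᵥ (layer φ d W l x).ofLp) i with hu
  have hui : ∀ i, u i = fun x => inner ℝ (WithLp.toLp 2 (W l i)) (layer φ d W l x) := fun i =>
    funext fun x => mulVec_apply_eq_inner _ _ _
  have huc : ∀ i, Continuous (u i) := fun i => by rw [hui]; exact hcont _
  have hum : ∀ i, Integrable (fun x => u i x ^ 4) μ ∧ ∫ x, u i x ^ 4 ∂μ ≤ Q / (d 0 : ℝ) ^ 2 ∧
      ∫ x, u i x ^ 2 ∂μ ≤ (Q + 1) / d 0 := fun i => by
    rw [hui]
    exact hmom _ ((norm_row_le (W l) i).trans ((H.norm_le l hl).trans (le_max_left _ _)))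
  have huu : ∀ i j, Integrable (fun x => u i x * u j x) μ := fun i j =>
    integrable_of_abs_le_pow_four (hum i).1 (hum j).1
      ((huc i).mul (huc j)).aestronglyMeasurable 1 fun x => abs_mul_le_one_add_pow_four _ _
  set T : ℝ := ∫ x, u i x * u j x ∂μ with hT
  have hTb : |T| ≤ (Q + 1) / d 0 := by
    refine abs_integral_le_integral_abs.trans ?_
    have i2 : ∀ i, Integrable (fun x => u i x ^ 2) μ := fun i => by simpa [sq] using huu i i
    refine (integral_mono_of_nonneg (Filter.Eventually.of_forall fun _ => abs_nonneg _)
      (((i2 i).add (i2 j)).div_const 2) (Filter.Eventually.of_forall fun x => ?_)).trans ?_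
    · simp only [Pi.add_apply]
      rw [abs_le]
      constructor <;> nlinarith [sq_nonneg (u i x - u j x), sq_nonneg (u i x + u j x)]
    · simp only [Pi.add_apply]
      rw [integral_div, integral_add (i2 i) (i2 j)]
      linarith [(hum i).2.2, (hum j).2.2]
  have hTcov : (W l * layerCov φ d W μ l * (W l)ᵀ) i j = T := by
    have e : ∀ x, u i x * u j x =
        ∑ k', ∑ k, W l i k * (layer φ d W l x k * layer φ d W l x k') * W l j k' := fun x => by
      simp only [hu, Matrix.mulVec, dotProduct]
      rw [Finset.sum_mul_sum, Finset.sum_comm]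
      refine Finset.sum_congr rfl fun k' _ => Finset.sum_congr rfl fun k _ => ?_
      ring
    rw [hT]
    simp only [e]
    have hi : ∀ k k', Integrable (fun x =>
        W l i k * (layer φ d W l x k * layer φ d W l x k') * W l j k') μ := fun k k' =>
      ((hxx k k').const_mul _).mul_const _
    rw [integral_finsetSum _ fun k' _ => integrable_finsetSum _ fun k _ => hi k k']
    simp only [Matrix.mul_apply, Matrix.transpose_apply, layerCov, Matrix.of_apply]
    refine Finset.sum_congr rfl fun k' _ => ?_
    rw [integral_finsetSum _ fun k _ => hi k k', Finset.sum_mul]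
    refine Finset.sum_congr rfl fun k _ => ?_
    rw [integral_mul_const, integral_const_mul]
  -- the layer variance
  set v := layerVar φ d W μ l with hv
  have hvdef : v = (∑ k, ∫ x, layer φ d W l x k ^ 2 ∂μ) / d l := by
    simp [hv, layerVar, Matrix.trace, layerCov, sq]
  have hv0 : 0 ≤ v := by
    rw [hvdef]
    exact div_nonneg (Finset.sum_nonneg fun k _ => integral_nonneg fun x => sq_nonneg _) hdl.le
  have hvb : v ≤ (Q + 1) / d 0 := by
    rw [hvdef, div_le_iff₀ hdl]
    refine (Finset.sum_le_sum fun k _ => (hxm k).2).trans (le_of_eq ?_)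
    simp [mul_comm]
  have hρ : |(rhoOne φ v ^ 2 - a ^ 2) * T| ≤
      3 * B ^ 2 * G * ((Q + 1) / d 0) * ((Q + 1) / d 0) := by
    -- If `v = 0`, then `rhoOne` is not close to `a`, but the layer vanishes almost everywhere and
    -- `T = 0`.
    rcases hv0.eq_or_lt with hv' | hv'
    · have hz : ∀ k, layerCov φ d W μ l k = 0 := fun k => by
        have hs : ∑ k, ∫ x, layer φ d W l x k ^ 2 ∂μ = 0 := by
          rw [← hv', eq_comm, div_eq_zero_iff] at hvdef
          exact hvdef.resolve_right hdl.ne'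
        have hk := (Finset.sum_eq_zero_iff_of_nonneg
          fun k _ => integral_nonneg fun x => sq_nonneg _).1 hs k (Finset.mem_univ k)
        have hik : Integrable (fun x => layer φ d W l x k ^ 2) μ := by simpa [sq] using hxx k k
        have hae := (integral_eq_zero_iff_of_nonneg (fun x => sq_nonneg _) hik).1 hk
        ext k'
        simp only [layerCov, Matrix.of_apply, Pi.zero_apply]
        refine integral_eq_zero_of_ae ?_
        filter_upwards [hae] with x hx
        have : layer φ d W l x k = 0 := by simpa using hx
        simp [this]
      have : T = 0 := by
        have hz' : layerCov φ d W μ l = 0 := funext hz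
        rw [← hTcov, hz']
        simp
      rw [this, mul_zero, abs_zero]
      positivity
    · rw [abs_mul]
      gcongr
      exact (h.abs_rhoOne_sq_sub_le hv').trans (by gcongr)
  have hρ2 : |rhoTwoSq φ v * (1 : Matrix (Fin (d (l + 1))) (Fin (d (l + 1))) ℝ) i j| ≤
      9 * B ^ 2 * G * ((Q + 1) / d 0) ^ 2 := by
    rw [abs_mul]
    refine (mul_le_of_le_one_right (abs_nonneg _) ?_).trans
      ((h.abs_rhoTwoSq_le hv0).trans (by gcongr))
    rw [Matrix.one_apply]
    split_ifs <;> simp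
  have hmain : |(∫ x, φ (u i x) * φ (u j x) ∂μ) - a ^ 2 * T| ≤
      3 * B ^ 2 * (2 * (Q / (d 0 : ℝ) ^ 2)) := by
    have hi4 : Integrable (fun x => 3 * B ^ 2 * (u i x ^ 4 + u j x ^ 4)) μ :=
      ((hum i).1.add (hum j).1).const_mul _
    have hdiff : Integrable (fun x => φ (u i x) * φ (u j x) - a ^ 2 * (u i x * u j x)) μ := by
      have := huc i
      have := huc j
      exact hi4.mono' (by fun_prop) (Filter.Eventually.of_forall fun x => h.abs_mul_sub_le _ _)
    have hφφ : Integrable (fun x => φ (u i x) * φ (u j x)) μ := by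
      have := hdiff.add ((huu i j).const_mul (a ^ 2))
      exact this.congr (Filter.Eventually.of_forall fun x => sub_add_cancel _ _)
    rw [hT, ← integral_const_mul, ← integral_sub hφφ ((huu i j).const_mul _)]
    refine abs_integral_le_integral_abs.trans ?_
    refine (integral_mono_of_nonneg (Filter.Eventually.of_forall fun _ => abs_nonneg _) hi4
      (Filter.Eventually.of_forall fun x => h.abs_mul_sub_le _ _)).trans ?_
    rw [integral_const_mul, integral_add (hum i).1 (hum j).1]
    gcongr
    linarith [(hum i).2.1, (hum j).2.1]
  have hentry : (layerCov φ d W μ (l + 1) - covStep φ d W μ l (layerCov φ d W μ l)) i j =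
      ((∫ x, φ (u i x) * φ (u j x) ∂μ) - a ^ 2 * T) - (rhoOne φ v ^ 2 - a ^ 2) * T -
        rhoTwoSq φ v * (1 : Matrix (Fin (d (l + 1))) (Fin (d (l + 1))) ℝ) i j := by
    simp only [covStep, layerRhoOne, layerRhoTwoSq, Matrix.sub_apply, Matrix.add_apply,
      Matrix.smul_apply, smul_eq_mul, hTcov]
    have : layerCov φ d W μ (l + 1) i j = ∫ x, φ (u i x) * φ (u j x) ∂μ := rfl
    rw [this]
    ring
  rw [hentry]
  refine (abs_sub _ _).trans ((add_le_add ((abs_sub _ _).trans (add_le_add hmain hρ)) hρ2).trans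
    (le_of_eq ?_))
  field_simp

end DeepRF

/-! ### From entries to operator norms, and the two recursions. -/

theorem mainTheorem2 (φ : ℝ → ℝ) (hφ : DeepRF.Activation φ) (L : ℕ)
    (c C K γ A : ℝ) (hc : 0 < c) (hC : 0 < C) (hK : 0 < K) (hγ : 1 ≤ γ) (hA : 0 < A) :
    ∃ M : ℝ, 0 < M ∧
      ∀ (d : ℕ → ℕ) (W : (k : ℕ) → Matrix (Fin (d (k + 1))) (Fin (d k)) ℝ)
        (μ : MeasureTheory.Measure (EuclideanSpace ℝ (Fin (d 0))))
        [MeasureTheory.IsProbabilityMeasure μ],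
        0 < d 0 →
        (∀ k ≤ L, (d 0 : ℝ) / γ ≤ d k ∧ (d k : ℝ) ≤ γ * d 0) →
        (∃ σ : ℝ, σ ^ 2 ≤ c / d 0 ∧ DeepRF.LCP μ σ) →
        (∫ x, x ∂μ) = 0 →
        (∀ k < L, DeepRF.NearOrthonormalRows (W k) C ∧ ‖W k‖ ≤ K) →
        ∀ l < L, ∀ δ : ℝ,
          (‖DeepRF.layerCov φ d W μ l - DeepRF.equivCov φ d W μ l‖ ≤ A * δ →
            ‖DeepRF.layerCov φ d W μ (l + 1) - DeepRF.equivCov φ d W μ (l + 1)‖ ≤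
              M * ((d (l + 1) : ℝ) / (d 0 : ℝ) ^ 2 +
                DeepRF.layerRhoOne φ d W μ l ^ 2 * ‖W l‖ ^ 2 * δ)) ∧
          (‖DeepRF.layerCov φ d W μ l - DeepRF.iterCov φ d W μ l‖ ≤ A * δ →
            ‖DeepRF.layerCov φ d W μ (l + 1) - DeepRF.iterCov φ d W μ (l + 1)‖ ≤
              M * ((d (l + 1) : ℝ) / (d 0 : ℝ) ^ 2 +
                DeepRF.layerRhoOne φ d W μ l ^ 2 * ‖W l‖ ^ 2 * δ)) := by
  obtain ⟨a, B, h⟩ := hφ.exists_cubicRemainder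
  choose N hN hNb using fun l => DeepRF.exists_entry_bound h (L := L) (c := c) (γ := γ) hK l
  -- Summing the layer constants makes the bound uniform in `l < L`.
  set N' := ∑ l ∈ Finset.range L, N l with hN'
  have hN'0 : 0 ≤ N' := Finset.sum_nonneg fun l _ => hN l
  refine ⟨N' + A, by positivity, fun d W μ _ hd hdim hconc hmean hW l hl δ => ?_⟩
  have hD : (0 : ℝ) < d 0 := by exact_mod_cast hd
  have H : DeepRF.Admissible L c K γ d W μ :=
    { pos := fun k hk => by
        have : (0 : ℝ) < d k := (div_pos hD (by linarith)).trans_le (hdim k hk).1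
        exact_mod_cast this
      dim_le := fun k hk => (hdim k hk).2
      concentration := hconc
      mean := hmean
      norm_le := fun k hk => (hW k hk).2 }
  set r := (d (l + 1) : ℝ) / (d 0 : ℝ) ^ 2 with hr
  have hr0 : 0 ≤ r := by positivity
  set S := DeepRF.layerCov φ d W μ with hS
  set ρ := DeepRF.layerRhoOne φ d W μ l with hρ
  have one_step : ‖S (l + 1) - DeepRF.covStep φ d W μ l (S l)‖ ≤ N' * r := by
    refine (DeepRF.l2_opNorm_le_card_mul _ (div_nonneg (hN l) (by positivity))
      (hNb l d W μ H hl)).trans ?_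
    have : N l ≤ N' := Finset.single_le_sum (fun l _ => hN l) (Finset.mem_range.2 hl)
    calc _ = N l * r := by rw [hr]; ring
      _ ≤ _ := by gcongr
  have hδ : ∀ {x : ℝ}, 0 ≤ x → x ≤ A * δ → 0 ≤ δ := fun hx hxδ =>
    nonneg_of_mul_nonneg_right (hx.trans hxδ) hA
  refine ⟨fun hl' => ?_, fun hl' => ?_⟩
  -- `one_step` already bounds the left side; the assumption on layer `l` supplies the sign of `δ`.
  · have hδ0 := hδ (norm_nonneg _) hl'
    have ht : 0 ≤ ρ ^ 2 * ‖W l‖ ^ 2 * δ := by positivity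
    refine one_step.trans ?_
    nlinarith [mul_nonneg hN'0 ht, mul_nonneg hA.le ht, mul_nonneg hA.le hr0]
  · have hδ0 := hδ (norm_nonneg _) hl'
    have ht : 0 ≤ ρ ^ 2 * ‖W l‖ ^ 2 * δ := by positivity
    -- Both recursions use the same coefficients, so the `ρ₂² I` terms cancel and the previous error
    -- is propagated linearly.
    have e : S (l + 1) - DeepRF.iterCov φ d W μ (l + 1) =
        (S (l + 1) - DeepRF.covStep φ d W μ l (S l)) +
          ρ ^ 2 • (W l * (S l - DeepRF.iterCov φ d W μ l) * (W l)ᵀ) := by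
      simp only [DeepRF.iterCov, DeepRF.covStep, Matrix.mul_sub, Matrix.sub_mul, smul_sub]
      abel
    have hprod : ‖W l * (S l - DeepRF.iterCov φ d W μ l) * (W l)ᵀ‖ ≤ ‖W l‖ * (A * δ) * ‖W l‖ := by
      have hT : ‖(W l)ᵀ‖ = ‖W l‖ := Matrix.l2_opNorm_conjTranspose (W l)
      refine (Matrix.l2_opNorm_mul _ _).trans ?_
      rw [hT]
      gcongr
      exact (Matrix.l2_opNorm_mul _ _).trans (by gcongr)
    rw [e]
    refine (norm_add_le _ _).trans ?_
    rw [norm_smul, Real.norm_eq_abs, abs_of_nonneg (sq_nonneg ρ)]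
    have := mul_le_mul_of_nonneg_left hprod (sq_nonneg ρ)
    nlinarith [mul_nonneg hN'0 ht, mul_nonneg hA.le hr0]
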